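/- Let $\boldsymbol\alpha=(\alpha_1,\dots,\alpha_{n_0})$, $n_0\ge 1$, be a vector of complex roots such that $\alpha_i-\alpha_j\notin 2\pi\mathrm i\,\mathbb Z$ for any two distinct roots $\alpha_i\ne\alpha_j$. Let $\alpha_{(1)},\dots,\alpha_{(n_d)}$ be the distinct roots, with multiplicities $n_{(1)},\dots,n_{(n_d)}$, and let $\mathrm L_{\boldsymbol\alpha}=(\mathrm D-\alpha_1\mathrm I)\cdots(\mathrm D-\alpha_{n_0}\mathrm I)$. Let $\beta^+_{\boldsymbol\alpha}$ be the exponential B-spline supported in $[0,n_0]$ with $\int_{\mathbb R}\beta^+_{\boldsymbol\alpha}(t)\mathrm e^{-\mathrm i\omega t}\,\mathrm dt=\prod_{n=1}^{n_0}\frac{1-\mathrm e^{\alpha_n-\mathrm i\omega}}{\mathrm i\omega-\alpha_n}$ (that is, the convolution of the functions $t\mapsto\mathrm e^{\alpha_n t}\mathbf 1_{[0,1)}(t)$), and let $\beta_{\boldsymbol\alpha}(t)=\beta^+_{\boldsymbol\alpha}(t+n_0/2)$. For a complex sequence $\lambda\in\ell_1(\mathbb Z)$ let $\phi_{\lambda,\boldsymbol\alpha}(t)=\sum_{n\in\mathbb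 Z}\lambda[n]\,\beta_{\boldsymbol\alpha}(t-n/2)$. We say that $g$ reproduces $p$ if there is a sequence $c:\mathbb Z\to\mathbb C$ such that, for every $t\in\mathbb R$, $\sum_{k\in\mathbb Z}c[k]\,g(t-k)$ converges absolutely with sum $p(t)$. Assume that, for every $\alpha\in\boldsymbol\alpha$, $$\sum_{n\in\mathbb Z}\bigl|\lambda[n]\,\mathrm e^{-\alpha n/2}\bigr|<\infty\qquad\text{and}\qquad\sum_{n\in\mathbb Z}\lambda[n]\,\mathrm e^{-\alpha n/2}\neq0 .$$ 1. For every $m\in\{1,\dots,n_d\}$ and $n\in\{1,\dots,n_{(m)}\}$ such that $\sum_{j\in\mathbb Z}|\lambda[j]|\,|j|^{n-1}\,|\mathrm e^{-\alpha_{(m)}j/2}|<\infty$ (which holds automatically if $n=1$, or if $\lambda$ has finitely many nonzero values), $\phi_{\lambda,\boldsymbol\alpha}$ reproduces $t^{n-1}\mathrm e^{\alpha_{(m)}t}$. 2. Suppose that $\sum_{j\in\mathbb Z}|\lambda[j]|\,|j|^{n_{(m)}-1}\,|\mathrm e^{-\alpha_{(m)}j/2}|<\infty$ for every $m$ (which is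 automatic if all roots are simple, or if $\lambda$ has finitely many nonzero values). Then $\phi_{\lambda,\boldsymbol\alpha}$ reproduces every $p\in C^{n_0}(\mathbb R;\mathbb C)$ with $\mathrm L_{\boldsymbol\alpha}p=0$. Moreover $\phi_{\lambda,\boldsymbol\alpha}$ has the same reproduction properties as $\beta_{\boldsymbol\alpha}$: an exponential polynomial (a finite linear combination of functions $t^j\mathrm e^{\gamma t}$ with $j\in\mathbb N$, $\gamma\in\mathbb C$) is reproduced by $\phi_{\lambda,\boldsymbol\alpha}$ if and only if it is reproduced by $\beta_{\boldsymbol\alpha}$. -/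

import Mathlib

open MeasureTheory

noncomputable section

/-- The causal first-order exponential B-spline `t ↦ exp (a t)` on `[0, 1)`, zero elsewhere. -/
def expBSplineOne (a : ℂ) : ℝ → ℂ :=
  (Set.Ico (0 : ℝ) 1).indicator fun t => Complex.exp (a * t)

/-- The causal exponential B-spline with list of roots `α`, supported in `[0, α.length]`: the
convolution of the first-order exponential B-splines of its roots. Its Fourier transform is computed
in `fourier_causalExpBSpline` below. The value at the empty list is a dummy. -/
def causalExpBSpline : List ℂ → ℝ → ℂ
  | [] => fun _ => 0
  | [a] => expBSplineOne a
  | a :: b :: as =>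
      convolution (expBSplineOne a) (causalExpBSpline (b :: as)) (ContinuousLinearMap.mul ℂ ℂ)
        volume

/-- The centered exponential B-spline, supported in `[-α.length / 2, α.length / 2]`. -/
def expBSpline (α : List ℂ) (t : ℝ) : ℂ :=
  causalExpBSpline α (t + (α.length : ℝ) / 2)

/-- The generator `∑ n, lam n * β (t - n / 2)`; for each `t` only finitely many terms are nonzero. -/
def generator (lam : ℤ → ℂ) (α : List ℂ) (t : ℝ) : ℂ :=
  ∑' n : ℤ, lam n * expBSpline α (t - (n : ℝ) / 2)

/-- The integer shifts of `g` reproduce `p`. -/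
def Reproduces (g p : ℝ → ℂ) : Prop :=
  ∃ c : ℤ → ℂ, ∀ t : ℝ, HasSum (fun k : ℤ => c k * g (t - (k : ℝ))) (p t)

/-- The exponential monomial `t ↦ t ^ j * exp (a t)`. -/
def expMonomial (j : ℕ) (a : ℂ) (t : ℝ) : ℂ :=
  (t : ℂ) ^ j * Complex.exp (a * t)

/-- Exponential polynomials: finite linear combinations of exponential monomials. -/
def IsExpPolynomial (p : ℝ → ℂ) : Prop :=
  p ∈ Submodule.span ℂ (Set.range fun q : ℕ × ℂ => expMonomial q.1 q.2)

/-- The differential operator `(D - α₁ I) ⋯ (D - αₙ I)`. -/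
def expDiffOp : List ℂ → (ℝ → ℂ) → ℝ → ℂ
  | [], p => p
  | a :: as, p => fun t => deriv (expDiffOp as p) t - a * expDiffOp as p t

/-- `∑ n, |lam n| |n| ^ j |exp (-a n / 2)| < ∞`. -/
def HasExpMoment (lam : ℤ → ℂ) (j : ℕ) (a : ℂ) : Prop :=
  Summable fun n : ℤ => ‖lam n‖ * |(n : ℝ)| ^ j * ‖Complex.exp (-a * n / 2)‖

/-! The Fourier transform of the causal exponential B-spline. -/

theorem integrable_expBSplineOne (a : ℂ) : Integrable (expBSplineOne a) := by
  unfold expBSplineOne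
  rw [integrable_indicator_iff measurableSet_Ico]
  exact ((by fun_prop : Continuous fun t : ℝ => Complex.exp (a * t)).integrableOn_Icc).mono_set
    Set.Ico_subset_Icc_self

theorem integrable_causalExpBSpline : ∀ α : List ℂ, Integrable (causalExpBSpline α)
  | [] => by simp [causalExpBSpline]
  | [a] => integrable_expBSplineOne a
  | a :: b :: as =>
      (integrable_expBSplineOne a).integrable_convolution (ContinuousLinearMap.mul ℂ ℂ)
        (integrable_causalExpBSpline (b :: as))

theorem expBSplineOne_mul_exp (a z : ℂ) (t : ℝ) :
    expBSplineOne a t * Complex.exp (-z * t) = expBSplineOne (a - z) t := by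
  unfold expBSplineOne
  by_cases h : t ∈ Set.Ico (0 : ℝ) 1
  · simp only [Set.indicator_of_mem h, ← Complex.exp_add]
    congr 1
    ring
  · simp [Set.indicator_of_notMem h]

theorem causalExpBSpline_mul_exp (z : ℂ) : ∀ (α : List ℂ) (t : ℝ),
    causalExpBSpline α t * Complex.exp (-z * t) = causalExpBSpline (α.map (· - z)) t
  | [], t => by simp [causalExpBSpline]
  | [a], t => expBSplineOne_mul_exp a z t
  | a :: b :: as, t => by
      have ih := causalExpBSpline_mul_exp z (b :: as)
      simp only [List.map_cons] at ih
      simp only [causalExpBSpline, List.map_cons, convolution, ContinuousLinearMap.mul_apply']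
      rw [← integral_mul_const]
      congr 1
      ext u
      rw [← ih, ← expBSplineOne_mul_exp]
      have : Complex.exp (-z * t) =
          Complex.exp (-z * u) * Complex.exp (-z * ((t - u : ℝ) : ℂ)) := by
        rw [← Complex.exp_add]
        congr 1
        push_cast
        ring
      rw [this]
      ring

theorem integral_expBSplineOne (a : ℂ) (ha : a ≠ 0) :
    ∫ t, expBSplineOne a t = (1 - Complex.exp a) / (-a) := by
  unfold expBSplineOne
  rw [integral_indicator measurableSet_Ico, integral_Ico_eq_integral_Ioc,
    ← intervalIntegral.integral_of_le zero_le_one, integral_exp_mul_complex ha]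
  simp
  rw [div_neg, ← neg_div]
  ring_nf

theorem integral_causalExpBSpline : ∀ α : List ℂ, α ≠ [] → (∀ a ∈ α, a ≠ 0) →
    ∫ t, causalExpBSpline α t = (α.map fun a => (1 - Complex.exp a) / (-a)).prod
  | [], h, _ => absurd rfl h
  | [a], _, h0 => by
      simpa [causalExpBSpline] using integral_expBSplineOne a (h0 a (by simp))
  | a :: b :: as, _, h0 => by
      have ih := integral_causalExpBSpline (b :: as) (by simp)
        fun x hx => h0 x (List.mem_cons_of_mem _ hx)
      rw [List.map_cons, List.prod_cons, ← ih, ← integral_expBSplineOne a (h0 a (by simp))]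
      simp only [causalExpBSpline]
      rw [integral_convolution (ContinuousLinearMap.mul ℂ ℂ) (integrable_expBSplineOne a)
        (integrable_causalExpBSpline (b :: as))]
      rfl

theorem fourier_causalExpBSpline (α : List ℂ) (hα : α ≠ []) (ω : ℝ)
    (hω : ∀ a ∈ α, Complex.I * ω ≠ a) :
    ∫ t : ℝ, causalExpBSpline α t * Complex.exp (-(Complex.I * ω) * t) =
      (α.map fun a => (1 - Complex.exp (a - Complex.I * ω)) / (Complex.I * ω - a)).prod := by
  simp only [causalExpBSpline_mul_exp]
  rw [integral_causalExpBSpline _ (by simpa using hα), List.map_map]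
  · congr 2
    ext a
    simp
  · intro x hx
    obtain ⟨a, ha, rfl⟩ := List.mem_map.1 hx
    exact sub_ne_zero.2 (hω a ha).symm

end

/-!
The proof rests on the space `expSpace α`, spanned by the exponential monomials
`t ^ j * exp (a t)` with `j` less than the multiplicity of `a` in `α`. Under the moment conditions
it is exactly the space of exponential polynomials reproduced by the generator; the B-spline is the
generator of the unit mass at `0`.

*Every element of `expSpace α` is reproduced.* After multiplication by `exp (-a t)` the root `a`
becomes `0`. The key fact (`hasConstMoments_causalExpBSpline`) is that for `i` less than the
multiplicity of the root `0` the function `t ^ i * β t` has a constant periodization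
`∑ k, (t - k) ^ i * β (t - k)`. The induction adds one root at a time: convolution with
`exp (b s)` on `[0, 1)` preserves constant periodizations, and for `b = 0` it is the mean over a
period, so that one further moment becomes constant. The constant for `i = 0` is `∫ β`, nonzero
because no root is a nonzero multiple of `2πi` (the assumption on the differences of the roots).
These facts pass to the generator by interchanging two sums (`HasConstMoments.tsum_half`), the
zeroth constant being multiplied by `∑ n, lam n * exp (-a n / 2)`. Then
`k = t - (t - k)` and the binomial theorem show that the coefficients `k ^ j * exp (a k)` produce a
nonzero multiple of `t ^ j * exp (a t)` plus terms of lower degree (`reproduces_expMonomial`).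

*No other exponential polynomial is reproduced.* On every half-integer interval the B-spline, hence
the generator, coincides with an element of `expSpace α`. Restrictions of a finite-dimensional space
are closed under pointwise limits, so a reproduced `p` agrees on an interval with an element of
`expSpace α`, and everywhere by analyticity (`mem_expSpace_of_reproduces`).

*The kernel of the differential operator is contained in `expSpace α`.* If `W' - a W` lies in
`expSpace r`, then `W` lies in `expSpace (a :: r)` (`mem_expSpace_cons_of_hasDerivAt`). This also
drives the induction for the pieces of the B-spline.
-/

noncomputable section

/-! ### Spaces of exponential polynomials -/

/-- The space of exponential polynomials attached to a list of roots: the span of the exponential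
monomials `t ^ j * exp (a t)` with `j` less than the multiplicity of `a`. -/
def expSpace (α : List ℂ) : Submodule ℂ (ℝ → ℂ) :=
  Submodule.span ℂ {f | ∃ j a, j < α.count a ∧ f = expMonomial j a}

theorem expMonomial_mem_expSpace {α : List ℂ} {j : ℕ} {a : ℂ} (h : j < α.count a) :
    expMonomial j a ∈ expSpace α :=
  Submodule.subset_span ⟨j, a, h, rfl⟩

theorem expSpace_le_cons (a : ℂ) (r : List ℂ) : expSpace r ≤ expSpace (a :: r) := by
  refine Submodule.span_mono ?_
  rintro _ ⟨j, b, h, rfl⟩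
  exact ⟨j, b, h.trans_le List.count_le_count_cons, rfl⟩

theorem finiteDimensional_expSpace (α : List ℂ) : FiniteDimensional ℂ (expSpace α) := by
  refine FiniteDimensional.span_of_finite ℂ ?_
  have : {f : ℝ → ℂ | ∃ j a, j < α.count a ∧ f = expMonomial j a} ⊆
      (fun q : ℕ × ℂ => expMonomial q.1 q.2) ''
        ((Finset.range α.length ×ˢ α.toFinset : Finset (ℕ × ℂ)) : Set (ℕ × ℂ)) := by
    rintro _ ⟨j, a, h, rfl⟩
    refine ⟨(j, a), ?_, rfl⟩
    simp only [Finset.coe_product, Set.mem_prod, Finset.mem_coe, Finset.mem_range,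
      List.mem_toFinset]
    exact ⟨h.trans_le List.count_le_length, List.count_pos_iff.1 (by omega)⟩
  exact (Set.Finite.image _ (Finset.finite_toSet _)).subset this

theorem expMonomial_add (j : ℕ) (a : ℂ) (t s : ℝ) :
    expMonomial j a (t + s) = ∑ i ∈ Finset.range (j + 1),
      ((s : ℂ) ^ (j - i) * j.choose i * Complex.exp (a * s)) * expMonomial i a t := by
  simp only [expMonomial]
  push_cast
  rw [add_pow, mul_add, Complex.exp_add, Finset.sum_mul]
  refine Finset.sum_congr rfl fun i _ => ?_
  ring

/-- The spaces of exponential polynomials are invariant under translation. -/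
theorem comp_add_mem_expSpace {α : List ℂ} {v : ℝ → ℂ} (hv : v ∈ expSpace α) (s : ℝ) :
    (fun t => v (t + s)) ∈ expSpace α := by
  induction hv using Submodule.span_induction with
  | mem f hf =>
    obtain ⟨j, a, h, rfl⟩ := hf
    have : (fun t => expMonomial j a (t + s)) = ∑ i ∈ Finset.range (j + 1),
        ((s : ℂ) ^ (j - i) * j.choose i * Complex.exp (a * s)) • expMonomial i a := by
      ext t
      simp [expMonomial_add, Finset.sum_apply]
    rw [this]
    refine Submodule.sum_mem _ fun i hi => Submodule.smul_mem _ _ (expMonomial_mem_expSpace ?_)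
    have := Finset.mem_range.1 hi
    omega
  | zero => exact Submodule.zero_mem _
  | add f g _ _ hf hg => exact Submodule.add_mem _ hf hg
  | smul c f _ hf => exact Submodule.smul_mem _ c hf

theorem hasDerivAt_cexp_mul (a : ℂ) (t : ℝ) :
    HasDerivAt (fun t : ℝ => Complex.exp (a * t)) (a * Complex.exp (a * t)) t := by
  have h : HasDerivAt (fun t : ℝ => a * (t : ℂ)) a t := by
    simpa using (Complex.ofRealCLM.hasDerivAt (x := t)).const_mul a
  simpa [mul_comm] using h.cexp

theorem hasDerivAt_expMonomial (j : ℕ) (a : ℂ) (t : ℝ) :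
    HasDerivAt (expMonomial j a) (a * expMonomial j a t + j * expMonomial (j - 1) a t) t := by
  have h1 : HasDerivAt (fun t : ℝ => (t : ℂ) ^ j) (j * (t : ℂ) ^ (j - 1)) t := by
    simpa using (Complex.ofRealCLM.hasDerivAt (x := t)).fun_pow j
  refine (h1.mul (hasDerivAt_cexp_mul a t)).congr_deriv ?_
  simp only [expMonomial]
  ring

/-- `D - a` maps the exponential polynomials of the roots `a :: r` onto those of the roots `r`. -/
theorem exists_solution_mem_expSpace (a : ℂ) {r : List ℂ} {v : ℝ → ℂ} (hv : v ∈ expSpace r) :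
    ∃ R ∈ expSpace (a :: r), ∀ t, HasDerivAt R (a * R t + v t) t := by
  induction hv using Submodule.span_induction with
  | mem f hf =>
    obtain ⟨j, b, h, rfl⟩ := hf
    by_cases hb : b = a
    · subst hb
      refine ⟨((j : ℂ) + 1)⁻¹ • expMonomial (j + 1) b,
        Submodule.smul_mem _ _ (expMonomial_mem_expSpace (by simpa using h)), fun t => ?_⟩
      refine ((hasDerivAt_expMonomial (j + 1) b t).const_smul ((j : ℂ) + 1)⁻¹).congr_deriv ?_
      have : (j : ℂ) + 1 ≠ 0 := Nat.cast_add_one_ne_zero j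
      simp only [smul_eq_mul, Pi.smul_apply, Nat.add_sub_cancel, Nat.cast_add, Nat.cast_one]
      field_simp
    · have hba : b - a ≠ 0 := sub_ne_zero.2 hb
      induction j with
      | zero =>
        refine ⟨(b - a)⁻¹ • expMonomial 0 b, Submodule.smul_mem _ _
          (expSpace_le_cons a r (expMonomial_mem_expSpace h)), fun t => ?_⟩
        refine ((hasDerivAt_expMonomial 0 b t).const_smul (b - a)⁻¹).congr_deriv ?_
        simp only [smul_eq_mul, Pi.smul_apply, Nat.cast_zero]
        field_simp
        ring
      | succ j ih =>
        obtain ⟨R, hR, hR'⟩ := ih (by omega)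
        refine ⟨(b - a)⁻¹ • (expMonomial (j + 1) b - ((j : ℂ) + 1) • R), Submodule.smul_mem _ _
          (Submodule.sub_mem _ (expSpace_le_cons a r (expMonomial_mem_expSpace h))
            (Submodule.smul_mem _ _ hR)), fun t => ?_⟩
        refine (((hasDerivAt_expMonomial (j + 1) b t).sub
          ((hR' t).const_smul ((j : ℂ) + 1))).const_smul (b - a)⁻¹).congr_deriv ?_
        simp only [smul_eq_mul, Pi.smul_apply, Pi.sub_apply, Nat.add_sub_cancel, Nat.cast_add,
          Nat.cast_one]
        field_simp
        ring
  | zero => exact ⟨0, Submodule.zero_mem _, fun t => by simp⟩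
  | add f g _ _ hf hg =>
    obtain ⟨R, hR, hR'⟩ := hf
    obtain ⟨S, hS, hS'⟩ := hg
    refine ⟨R + S, Submodule.add_mem _ hR hS, fun t => ?_⟩
    refine ((hR' t).add (hS' t)).congr_deriv ?_
    simp only [Pi.add_apply]
    ring
  | smul c f _ hf =>
    obtain ⟨R, hR, hR'⟩ := hf
    refine ⟨c • R, Submodule.smul_mem _ _ hR, fun t => ?_⟩
    refine ((hR' t).const_smul c).congr_deriv ?_
    simp only [Pi.smul_apply, smul_eq_mul]
    ring

theorem eq_const_mul_cexp {a : ℂ} {W : ℝ → ℂ} (hW : ∀ t, HasDerivAt W (a * W t) t) (t : ℝ) :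
    W t = W 0 * Complex.exp (a * t) := by
  have h : ∀ t : ℝ, HasDerivAt (fun t : ℝ => W t * Complex.exp (-a * t)) 0 t := fun t => by
    refine ((hW t).mul (hasDerivAt_cexp_mul (-a) t)).congr_deriv ?_
    ring
  have hc := is_const_of_deriv_eq_zero (fun t => (h t).differentiableAt)
    (fun t => (h t).deriv) t 0
  simp only [Complex.ofReal_zero, mul_zero, Complex.exp_zero, mul_one] at hc
  rw [← hc, mul_assoc, ← Complex.exp_add]
  simp

theorem mem_expSpace_cons_of_hasDerivAt {a : ℂ} {r : List ℂ} {v W : ℝ → ℂ} (hv : v ∈ expSpace r)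
    (hW : ∀ t, HasDerivAt W (a * W t + v t) t) : W ∈ expSpace (a :: r) := by
  obtain ⟨R, hR, hR'⟩ := exists_solution_mem_expSpace a hv
  have h : ∀ t, HasDerivAt (W - R) (a * (W - R) t) t := fun t => by
    refine ((hW t).sub (hR' t)).congr_deriv ?_
    simp only [Pi.sub_apply]
    ring
  have h2 : W = R + (W - R) 0 • expMonomial 0 a := by
    ext t
    have := eq_const_mul_cexp h t
    simp only [Pi.sub_apply] at this
    simp [expMonomial, ← this]
  rw [h2]
  exact Submodule.add_mem _ hR (Submodule.smul_mem _ _ (expMonomial_mem_expSpace (by simp)))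

/-! ### The kernel of the differential operator -/

/-- Applying the operator costs one derivative for each root. -/
theorem contDiff_expDiffOp (α : List ℂ) (m : ℕ) {p : ℝ → ℂ}
    (hp : ContDiff ℝ (α.length + m : ℕ) p) : ContDiff ℝ m (expDiffOp α p) := by
  induction α generalizing m with
  | nil => simpa [expDiffOp] using hp
  | cons a as ih =>
    have h := ih (m + 1) (by
      convert hp using 2
      simp only [List.length_cons]
      ring)
    simp only [expDiffOp]
    have h1 : ContDiff ℝ m (deriv (expDiffOp as p)) := by
      have h' : ContDiff ℝ ((m : WithTop ℕ∞) + 1) (expDiffOp as p) := by exact_mod_cast h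
      exact (contDiff_succ_iff_deriv.1 h').2.2
    exact h1.sub (contDiff_const.mul (h.of_le (by exact_mod_cast Nat.le_succ m)))

/-- The innermost factor of the differential operator may be exchanged with the others. -/
theorem expDiffOp_cons_comm (a : ℂ) (α : List ℂ) {p : ℝ → ℂ}
    (hp : ContDiff ℝ (α.length + 1 : ℕ) p) :
    expDiffOp (a :: α) p = expDiffOp α fun t => deriv p t - a * p t := by
  induction α generalizing p with
  | nil => rfl
  | cons b as ih =>
    have h2 : ContDiff ℝ (2 : ℕ) (expDiffOp as p) := contDiff_expDiffOp as 2 hp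
    have h2' : ContDiff ℝ ((1 : WithTop ℕ∞) + 1) (expDiffOp as p) := by
      convert h2 using 1
      norm_num
    have hd : Differentiable ℝ (expDiffOp as p) := h2.differentiable (by norm_num)
    have hdd : Differentiable ℝ (deriv (expDiffOp as p)) :=
      (contDiff_succ_iff_deriv.1 h2').2.2.differentiable (by norm_num)
    have ih' := ih (hp.of_le (by
      simp only [List.length_cons]; exact_mod_cast Nat.le_succ _))
    ext t
    simp only [expDiffOp] at ih' ⊢
    rw [← ih']
    have e : ∀ c t, deriv (fun t => deriv (expDiffOp as p) t - c * expDiffOp as p t) t =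
        deriv (deriv (expDiffOp as p)) t - c * deriv (expDiffOp as p) t := fun c t =>
      ((hdd t).hasDerivAt.sub ((hd t).hasDerivAt.const_mul c)).deriv
    rw [e, e]
    ring

theorem mem_expSpace_of_expDiffOp_eq_zero (α : List ℂ) {p : ℝ → ℂ}
    (hp : ContDiff ℝ α.length p) (h : ∀ t, expDiffOp α p t = 0) : p ∈ expSpace α := by
  induction α generalizing p with
  | nil =>
    have : p = 0 := funext h
    rw [this]
    exact Submodule.zero_mem _
  | cons a as ih =>
    rw [expDiffOp_cons_comm a as (by simpa using hp)] at h
    have hp' : ContDiff ℝ ((as.length : WithTop ℕ∞) + 1) p := by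
      convert hp using 1
      simp
    have hc : ContDiff ℝ as.length fun t => deriv p t - a * p t :=
      (contDiff_succ_iff_deriv.1 hp').2.2.sub
        (contDiff_const.mul (hp'.of_le le_self_add))
    refine mem_expSpace_cons_of_hasDerivAt (ih hc h) fun t => ?_
    refine ((hp'.differentiable (by simp)) t).hasDerivAt.congr_deriv ?_
    ring

/-! ### Analyticity of exponential polynomials -/

theorem analyticOnNhd_expMonomial (j : ℕ) (a : ℂ) :
    AnalyticOnNhd ℝ (expMonomial j a) Set.univ := by
  intro t _
  have h : AnalyticAt ℝ (fun t : ℝ => (t : ℂ)) t := Complex.ofRealCLM.analyticAt t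
  have h1 : AnalyticAt ℝ Complex.exp (a * (t : ℂ)) :=
    AnalyticAt.restrictScalars (𝕜 := ℝ) (𝕜' := ℂ) analyticAt_cexp
  have h2 : AnalyticAt ℝ (fun t : ℝ => Complex.exp (a * (t : ℂ))) t :=
    h1.comp (f := fun t : ℝ => a * (t : ℂ)) (analyticAt_const.mul h)
  exact (h.pow j).mul h2

theorem IsExpPolynomial.analyticOnNhd {p : ℝ → ℂ} (hp : IsExpPolynomial p) :
    AnalyticOnNhd ℝ p Set.univ := by
  unfold IsExpPolynomial at hp
  induction hp using Submodule.span_induction with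
  | mem f hf =>
    obtain ⟨q, rfl⟩ := hf
    exact analyticOnNhd_expMonomial _ _
  | zero => exact analyticOnNhd_const
  | add f g _ _ hf hg => exact hf.add hg
  | smul c f _ hf => exact (analyticOnNhd_const (v := c)).mul hf

theorem isExpPolynomial_of_mem_expSpace {α : List ℂ} {v : ℝ → ℂ} (hv : v ∈ expSpace α) :
    IsExpPolynomial v := by
  refine Submodule.span_mono ?_ hv
  rintro _ ⟨j, a, -, rfl⟩
  exact ⟨(j, a), rfl⟩

/-! ### B-splines as piecewise exponential polynomials -/

theorem causalExpBSpline_cons (a : ℂ) {r : List ℂ} (hr : r ≠ []) (t : ℝ) :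
    causalExpBSpline (a :: r) t =
      ∫ s in (0 : ℝ)..1, Complex.exp (a * s) * causalExpBSpline r (t - s) := by
  obtain ⟨b, as, rfl⟩ := List.exists_cons_of_ne_nil hr
  simp only [causalExpBSpline, convolution, ContinuousLinearMap.mul_apply', expBSplineOne]
  rw [intervalIntegral.integral_of_le zero_le_one, ← integral_Ico_eq_integral_Ioc,
    ← integral_indicator measurableSet_Ico]
  congr 1
  ext s
  by_cases h : s ∈ Set.Ico (0 : ℝ) 1 <;> simp [h]

theorem causalExpBSpline_eq_zero (α : List ℂ) {t : ℝ} (ht : t ∉ Set.Icc (0 : ℝ) α.length) :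
    causalExpBSpline α t = 0 := by
  induction α generalizing t with
  | nil => rfl
  | cons a r ih =>
    by_cases hr : r = []
    · subst hr
      have : t ∉ Set.Ico (0 : ℝ) 1 := fun h => ht (by simpa using Set.Ico_subset_Icc_self h)
      simp [causalExpBSpline, expBSplineOne, Set.indicator_of_notMem this]
    · rw [causalExpBSpline_cons a hr]
      refine intervalIntegral.integral_zero_ae (Filter.Eventually.of_forall fun s hs => ?_)
      rw [ih, mul_zero]
      rw [Set.uIoc_of_le zero_le_one] at hs
      intro h
      apply ht
      simp only [List.length_cons, Nat.cast_add, Nat.cast_one]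
      exact ⟨by linarith [h.1, hs.1], by linarith [h.2, hs.2]⟩

/-- A function vanishing outside a bounded interval has finitely many half-integer translates that
are nonzero at a given point. -/
theorem summable_mul_comp_sub_half {f : ℝ → ℂ} {A B : ℝ} (hf : ∀ t ∉ Set.Icc A B, f t = 0)
    (w : ℤ → ℂ) (t : ℝ) : Summable fun n : ℤ => w n * f (t - (n : ℝ) / 2) := by
  refine summable_of_ne_finset_zero (s := Finset.Icc ⌊2 * (t - B)⌋ ⌈2 * (t - A)⌉) fun n hn => ?_
  rw [hf, mul_zero]
  intro h
  apply hn
  rw [Finset.mem_Icc]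
  constructor
  · have h3 : 2 * (t - B) ≤ n := by linarith [h.2]
    exact_mod_cast (Int.floor_le (2 * (t - B))).trans h3
  · have := (Int.le_ceil (2 * (t - A)))
    have h3 : (n : ℝ) ≤ 2 * (t - A) := by linarith [h.1]
    exact_mod_cast h3.trans this

/-- Functions that coincide on every half-integer interval with an exponential polynomial of the
roots `α`. -/
def IsPiecewiseExp (α : List ℂ) (f : ℝ → ℂ) : Prop :=
  ∀ m : ℤ, ∃ v ∈ expSpace α, ∀ t ∈ Set.Ico ((m : ℝ) / 2) (((m : ℝ) + 1) / 2), f t = v t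

theorem IsPiecewiseExp.const_mul {α : List ℂ} {f : ℝ → ℂ} (hf : IsPiecewiseExp α f) (c : ℂ) :
    IsPiecewiseExp α fun t => c * f t := fun m => by
  obtain ⟨v, hv, h⟩ := hf m
  exact ⟨c • v, Submodule.smul_mem _ c hv, fun t ht => by simp [h t ht]⟩

theorem IsPiecewiseExp.comp_add_half {α : List ℂ} {f : ℝ → ℂ} (hf : IsPiecewiseExp α f) (n : ℤ) :
    IsPiecewiseExp α fun t => f (t + (n : ℝ) / 2) := fun m => by
  obtain ⟨v, hv, h⟩ := hf (m + n)
  refine ⟨_, comp_add_mem_expSpace hv ((n : ℝ) / 2), fun t ht => h _ ?_⟩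
  push_cast
  exact ⟨by linarith [ht.1], by linarith [ht.2]⟩

/-- The spaces of exponential polynomials are finite-dimensional, so their restrictions to an
interval are closed under pointwise sums. -/
theorem IsPiecewiseExp.of_hasSum {α : List ℂ} {ι : Type*} {F : ι → ℝ → ℂ} {f : ℝ → ℂ}
    (hF : ∀ i, IsPiecewiseExp α (F i)) (h : ∀ t, HasSum (fun i => F i t) (f t)) :
    IsPiecewiseExp α f := fun m => by
  have := finiteDimensional_expSpace α
  set I := Set.Ico ((m : ℝ) / 2) (((m : ℝ) + 1) / 2)
  let res : (ℝ → ℂ) →ₗ[ℂ] (I → ℂ) := LinearMap.funLeft ℂ ℂ Subtype.val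
  have hmem : ∀ i, res (F i) ∈ (expSpace α).map res := fun i => by
    obtain ⟨v, hv, hvF⟩ := hF i m
    exact ⟨v, hv, funext fun t => (hvF t t.2).symm⟩
  have hsum : HasSum (fun i => res (F i)) (res f) := Pi.hasSum.2 fun t => h t
  have hcl : IsClosed ((expSpace α).map res : Set (I → ℂ)) :=
    Submodule.closed_of_finiteDimensional _
  obtain ⟨v, hv, hvf⟩ := hcl.mem_of_tendsto hsum
    (Filter.Eventually.of_forall fun s => Submodule.sum_mem _ fun i _ => hmem i)
  exact ⟨v, hv, fun t ht => (congrFun hvf ⟨t, ht⟩).symm⟩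

theorem IsPiecewiseExp.convolution_expBSplineOne {r : List ℂ} {f : ℝ → ℂ}
    (hf : IsPiecewiseExp r f) (hfi : Integrable f) (a : ℂ) :
    IsPiecewiseExp (a :: r) fun t => ∫ s in (0 : ℝ)..1, Complex.exp (a * s) * f (t - s) := by
  intro m
  obtain ⟨v, hv, hvf⟩ := hf m
  obtain ⟨u, hu, huf⟩ := hf (m - 2)
  set x : ℝ := (m : ℝ) / 2
  set h : ℝ → ℂ := fun y => Complex.exp (-a * y) * f y
  have hE : Continuous fun y : ℝ => Complex.exp (-a * y) := by fun_prop
  have hi : ∀ p q : ℝ, IntervalIntegrable h volume p q := fun p q =>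
    hfi.intervalIntegrable.continuousOn_mul hE.continuousOn
  have hvc : Continuous v :=
    continuousOn_univ.1 (isExpPolynomial_of_mem_expSpace hv).analyticOnNhd.continuousOn
  have huc : Continuous u :=
    continuousOn_univ.1 (isExpPolynomial_of_mem_expSpace hu).analyticOnNhd.continuousOn
  set k : ℝ → ℂ := fun y => Complex.exp (-a * y) * v y
  set l : ℝ → ℂ := fun y => Complex.exp (-a * ((y - 1 : ℝ) : ℂ)) * u (y - 1)
  have hk : Continuous k := by fun_prop
  have hl : Continuous l := by fun_prop
  set C : ℂ := ∫ y in (x - 1)..x, h y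
  set W : ℝ → ℂ := fun t => Complex.exp (a * t) * (C + ∫ y in x..t, (k y - l y))
  have hW : ∀ t, HasDerivAt W
      (a * W t + (v + (-Complex.exp a) • fun t => u (t + (-1))) t) t := fun t => by
    have hd : HasDerivAt (fun t => C + ∫ y in x..t, (k y - l y)) (k t - l t) t :=
      ((hk.sub hl).integral_hasStrictDerivAt x t).hasDerivAt.const_add C
    refine ((hasDerivAt_cexp_mul a t).mul hd).congr_deriv ?_
    have e1 : Complex.exp (a * t) * k t = v t := by
      simp only [k]
      rw [← mul_assoc, ← Complex.exp_add]
      simp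
    have e2 : Complex.exp (a * t) * l t = Complex.exp a * u (t + -1) := by
      simp only [l]
      rw [← mul_assoc, ← Complex.exp_add, ← sub_eq_add_neg]
      congr 2
      push_cast
      ring
    simp only [Pi.add_apply, Pi.smul_apply, smul_eq_mul, W]
    rw [mul_sub, e1, e2]
    ring
  refine ⟨W, mem_expSpace_cons_of_hasDerivAt (Submodule.add_mem _ hv
    (Submodule.smul_mem _ _ (comp_add_mem_expSpace hu (-1)))) hW, fun t ht => ?_⟩
  -- The window `[t - 1, t]` is split at the grid points `x - 1` and `x`.
  have e1 : ∫ s in (0 : ℝ)..1, Complex.exp (a * s) * f (t - s) =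
      Complex.exp (a * t) * ∫ y in (t - 1)..t, h y := by
    have := intervalIntegral.integral_comp_sub_left (a := 0) (b := 1) h t
    rw [sub_zero] at this
    rw [← this, ← intervalIntegral.integral_const_mul]
    refine intervalIntegral.integral_congr fun s _ => ?_
    simp only [h]
    rw [← mul_assoc, ← Complex.exp_add]
    congr 2
    push_cast
    ring
  have e2 : ∫ y in x..t, h y = ∫ y in x..t, k y := by
    refine intervalIntegral.integral_congr fun y hy => ?_
    rw [Set.uIcc_of_le ht.1] at hy
    simp only [h, k]
    rw [hvf y ⟨hy.1, hy.2.trans_lt ht.2⟩]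
  have e3 : ∫ y in (x - 1)..(t - 1), h y = ∫ y in x..t, l y := by
    rw [← intervalIntegral.integral_comp_sub_right]
    refine intervalIntegral.integral_congr fun y hy => ?_
    rw [Set.uIcc_of_le ht.1] at hy
    simp only [h, l]
    rw [huf (y - 1) ?_]
    push_cast
    have h1 := hy.1
    have h2 := hy.2.trans_lt ht.2
    simp only [x] at h1
    exact ⟨by linarith, by linarith⟩
  have e4 : ∫ y in (t - 1)..t, h y =
      C + (∫ y in x..t, h y) - ∫ y in (x - 1)..(t - 1), h y := by
    have := intervalIntegral.integral_add_adjacent_intervals (hi (x - 1) (t - 1)) (hi (t - 1) t)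
    have h2 := intervalIntegral.integral_add_adjacent_intervals (hi (x - 1) x) (hi x t)
    rw [h2, ← this]
    ring
  simp only [W]
  rw [e1, e4, e2, e3, intervalIntegral.integral_sub (hk.intervalIntegrable _ _)
    (hl.intervalIntegrable _ _)]
  ring

theorem isPiecewiseExp_causalExpBSpline (α : List ℂ) :
    IsPiecewiseExp α (causalExpBSpline α) := by
  induction α with
  | nil => exact fun m => ⟨0, Submodule.zero_mem _, fun t _ => rfl⟩
  | cons a r ih =>
    by_cases hr : r = []
    · subst hr
      intro m
      by_cases hm : 0 ≤ m ∧ m ≤ 1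
      · refine ⟨expMonomial 0 a, expMonomial_mem_expSpace (by simp), fun t ht => ?_⟩
        have h0 : (0 : ℝ) ≤ m := by exact_mod_cast hm.1
        have h1 : (m : ℝ) ≤ 1 := by exact_mod_cast hm.2
        have : t ∈ Set.Ico (0 : ℝ) 1 := ⟨by linarith [ht.1], by linarith [ht.2]⟩
        simp [causalExpBSpline, expBSplineOne, expMonomial, Set.indicator_of_mem this]
      · refine ⟨0, Submodule.zero_mem _, fun t ht => ?_⟩
        have : t ∉ Set.Ico (0 : ℝ) 1 := fun h => hm ?_
        · simp [causalExpBSpline, expBSplineOne, Set.indicator_of_notMem this]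
        have h1 : (-1 : ℝ) < m := by linarith [h.1, ht.2]
        have h2 : (m : ℝ) < 2 := by linarith [h.2, ht.1]
        have h1' : -1 < m := by exact_mod_cast h1
        have h2' : m < 2 := by exact_mod_cast h2
        omega
    · have := ih.convolution_expBSplineOne (integrable_causalExpBSpline r) a
      simpa only [← causalExpBSpline_cons a hr] using this

theorem expBSpline_eq_zero (α : List ℂ) {t : ℝ}
    (ht : t ∉ Set.Icc (-((α.length : ℝ) / 2)) ((α.length : ℝ) / 2)) : expBSpline α t = 0 := by
  refine causalExpBSpline_eq_zero α fun h => ht ⟨by linarith [h.1], by linarith [h.2]⟩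

theorem isPiecewiseExp_generator (lam : ℤ → ℂ) (α : List ℂ) :
    IsPiecewiseExp α (generator lam α) := by
  refine IsPiecewiseExp.of_hasSum (F := fun (n : ℤ) t => lam n * expBSpline α (t - (n : ℝ) / 2))
    (fun n => ?_) fun t =>
      (summable_mul_comp_sub_half (fun t ht => expBSpline_eq_zero α ht) lam t).hasSum
  have := ((isPiecewiseExp_causalExpBSpline α).comp_add_half (α.length - n)).const_mul (lam n)
  convert this using 3
  simp only [expBSpline]
  congr 1
  push_cast
  ring

/-- An exponential polynomial reproduced by a generator satisfies the differential equation: on a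
half-integer interval it is a sum of exponential polynomials of the roots `α`, and analyticity
extends the resulting identity to the line. -/
theorem mem_expSpace_of_reproduces {α : List ℂ} {g p : ℝ → ℂ} (hg : IsPiecewiseExp α g)
    (hp : IsExpPolynomial p) (h : Reproduces g p) : p ∈ expSpace α := by
  obtain ⟨c, hc⟩ := h
  have hpw : IsPiecewiseExp α p := by
    refine IsPiecewiseExp.of_hasSum (fun k : ℤ => ?_) hc
    convert (hg.comp_add_half (-2 * k)).const_mul (c k) using 4
    push_cast
    ring
  obtain ⟨v, hv, hvp⟩ := hpw 0
  have : p = v := by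
    refine hp.analyticOnNhd.eq_of_eventuallyEq (isExpPolynomial_of_mem_expSpace hv).analyticOnNhd
      (z₀ := 1 / 4) ?_
    filter_upwards [Ioo_mem_nhds (show (0 : ℝ) < 1 / 4 by norm_num)
      (show (1 / 4 : ℝ) < 1 / 2 by norm_num)] with t ht
    exact hvp t ⟨by simpa using ht.1.le, by simpa using ht.2⟩
  exact this ▸ hv

/-! ### Periodizations -/

/-- The sum of the integer translates of `f` converges to the constant `c`. -/
def HasPeriodization (f : ℝ → ℂ) (c : ℂ) : Prop :=
  ∀ t : ℝ, HasSum (fun k : ℤ => f (t - (k : ℝ))) c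

/-- The functions `t ↦ t ^ i * f t`, `i < N`, have constant periodizations. -/
def HasConstMoments (f : ℝ → ℂ) (N : ℕ) : Prop :=
  ∀ i < N, ∃ c, HasPeriodization (fun t => (t : ℂ) ^ i * f t) c

theorem HasPeriodization.const_mul {f : ℝ → ℂ} {c : ℂ} (h : HasPeriodization f c) (z : ℂ) :
    HasPeriodization (fun t => z * f t) (z * c) := fun t => (h t).mul_left z

theorem HasPeriodization.comp_add {f : ℝ → ℂ} {c : ℂ} (h : HasPeriodization f c) (s : ℝ) :
    HasPeriodization (fun t => f (t + s)) c := fun t => by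
  simpa only [sub_add_eq_add_sub] using h (t + s)

theorem HasPeriodization.sum {ι : Type*} {s : Finset ι} {F : ι → ℝ → ℂ} {c : ι → ℂ}
    (h : ∀ i ∈ s, HasPeriodization (F i) (c i)) :
    HasPeriodization (fun t => ∑ i ∈ s, F i t) (∑ i ∈ s, c i) := fun t =>
  hasSum_sum fun i hi => h i hi t

/-- Moments of a function built from the translates of `f`: the power of the variable is expanded
around the translation parameter `s`. -/
theorem ofReal_pow_mul_eq_sum (i : ℕ) (t s : ℝ) (z : ℂ) :
    (t : ℂ) ^ i * z =
      ∑ l ∈ Finset.range (i + 1), i.choose l * ((s : ℂ) ^ l * (((t - s : ℝ) : ℂ) ^ (i - l) * z)) := by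
  have : (t : ℂ) = s + ((t - s : ℝ) : ℂ) := by
    push_cast
    ring
  conv_lhs => rw [this, add_pow, Finset.sum_mul]
  refine Finset.sum_congr rfl fun l _ => ?_
  ring

theorem HasConstMoments.comp_add {f : ℝ → ℂ} {N : ℕ} (h : HasConstMoments f N) (s : ℝ) :
    HasConstMoments (fun t => f (t + s)) N := fun i hi => by
  choose! c hc using h
  refine ⟨∑ l ∈ Finset.range (i + 1), i.choose l * (((-s : ℝ) : ℂ) ^ l * c (i - l)), ?_⟩
  have := HasPeriodization.sum (s := Finset.range (i + 1)) fun l _ =>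
    (((hc (i - l) (by omega)).comp_add s).const_mul (((-s : ℝ) : ℂ) ^ l)).const_mul (i.choose l)
  convert this using 2 with t
  rw [ofReal_pow_mul_eq_sum i t (-s)]
  simp only [sub_neg_eq_add]

theorem HasConstMoments.const_mul {f : ℝ → ℂ} {N : ℕ} (h : HasConstMoments f N) (z : ℂ) :
    HasConstMoments (fun t => z * f t) N := fun i hi => by
  obtain ⟨c, hc⟩ := h i hi
  refine ⟨z * c, ?_⟩
  convert hc.const_mul z using 2
  ring

theorem hasSum_integral_comp_sub {E : Type*} [NormedAddCommGroup E] [NormedSpace ℝ E] {f : ℝ → E}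
    (hf : Integrable f) (t : ℝ) :
    HasSum (fun k : ℤ => ∫ s in (0 : ℝ)..1, f (t - (k : ℝ) - s)) (∫ s, f s) := by
  have h := (Equiv.neg ℤ).hasSum_iff.2 (hf.hasSum_intervalIntegral (t - 1))
  refine h.congr_fun fun k => ?_
  simp only [intervalIntegral.integral_comp_sub_left, Function.comp, Equiv.neg_apply]
  congr 1 <;> push_cast <;> ring

/-- Averaging over a window of length one makes any periodization constant. -/
theorem hasPeriodization_window {f : ℝ → ℂ} (hf : Integrable f) :
    HasPeriodization (fun t => ∫ s in (0 : ℝ)..1, f (t - s)) (∫ s, f s) := fun t =>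
  hasSum_integral_comp_sub hf t

theorem HasPeriodization.window_mul {f : ℝ → ℂ} {c : ℂ} (h : HasPeriodization f c)
    (hf : Integrable f) {w : ℝ → ℂ} (hw : Continuous w) :
    HasPeriodization (fun t => ∫ s in (0 : ℝ)..1, w s * f (t - s))
      ((∫ s in (0 : ℝ)..1, w s) * c) := fun t => by
  obtain ⟨C, hC⟩ := isCompact_Icc.exists_bound_of_continuousOn (s := Set.Icc (0 : ℝ) 1)
    hw.continuousOn
  have hfk : ∀ k : ℤ, Integrable fun s => f (t - (k : ℝ) - s) := fun k =>
    hf.comp_sub_left (t - (k : ℝ))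
  have hint : ∀ k : ℤ, Integrable (fun s => w s * f (t - (k : ℝ) - s))
      (volume.restrict (Set.Ioc (0 : ℝ) 1)) := fun k =>
    ((hfk k).integrableOn.continuousOn_mul hw.continuousOn isCompact_Icc).mono_set
      Set.Ioc_subset_Icc_self
  have hle : ∀ k : ℤ, ∫ s in Set.Ioc (0 : ℝ) 1, ‖w s * f (t - (k : ℝ) - s)‖ ≤
      C * ∫ s in (0 : ℝ)..1, ‖f (t - (k : ℝ) - s)‖ := fun k => by
    rw [intervalIntegral.integral_of_le zero_le_one, ← integral_const_mul]
    refine setIntegral_mono_on (hint k).norm ((hfk k).norm.integrableOn.const_mul C)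
      measurableSet_Ioc fun s hs => ?_
    rw [norm_mul]
    exact mul_le_mul_of_nonneg_right (hC s (Set.Ioc_subset_Icc_self hs)) (norm_nonneg _)
  have hsum : Summable fun k : ℤ => ∫ s in Set.Ioc (0 : ℝ) 1, ‖w s * f (t - (k : ℝ) - s)‖ :=
    Summable.of_nonneg_of_le (fun k => integral_nonneg fun s => norm_nonneg _) hle
      ((hasSum_integral_comp_sub hf.norm t).summable.mul_left C)
  have := hasSum_integral_of_summable_integral_norm hint hsum
  have e : ∀ s : ℝ, ∑' k : ℤ, w s * f (t - (k : ℝ) - s) = w s * c := fun s => by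
    have h' := (h (t - s)).mul_left (w s)
    simp only [sub_right_comm t s] at h'
    exact h'.tsum_eq
  simp only [e, integral_mul_const] at this
  simpa only [intervalIntegral.integral_of_le (zero_le_one (α := ℝ))] using this

theorem HasPeriodization.eq_integral {f : ℝ → ℂ} {c : ℂ} (h : HasPeriodization f c)
    (hf : Integrable f) : c = ∫ s, f s := by
  have h1 := h.window_mul hf (w := fun _ => 1) continuous_const
  simp only [one_mul] at h1
  simpa using (h1 0).unique (hasSum_integral_comp_sub hf 0)

/-! ### Moments of B-splines -/

theorem integrable_pow_mul_causalExpBSpline (α : List ℂ) (i : ℕ) :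
    Integrable fun t : ℝ => (t : ℂ) ^ i * causalExpBSpline α t := by
  have h : IntegrableOn (fun t : ℝ => (t : ℂ) ^ i * causalExpBSpline α t)
      (Set.Icc 0 α.length) :=
    (integrable_causalExpBSpline α).integrableOn.continuousOn_mul
      (by fun_prop : Continuous fun t : ℝ => (t : ℂ) ^ i).continuousOn isCompact_Icc
  refine (integrableOn_iff_integrable_of_support_subset fun t ht => ?_).1 h
  by_contra hn
  exact ht (by simp only [causalExpBSpline_eq_zero α hn, mul_zero])

/-- If no root is a nonzero multiple of `2πi`, multiplying the B-spline by a power of the variable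
less than the multiplicity of the root `0` leaves a constant periodization. When a root `0` is
added, the moment of the highest order becomes constant because of the integration over a full
period. -/
theorem hasConstMoments_causalExpBSpline (α : List ℂ) :
    HasConstMoments (causalExpBSpline α) (α.count 0) := by
  induction α with
  | nil => exact fun i hi => absurd hi (by simp)
  | cons b r ih =>
    intro i hi
    by_cases hr : r = []
    · subst hr
      have hb : b = 0 := by
        by_contra hb
        simp [hb] at hi
      subst hb
      obtain rfl : i = 0 := by simpa using hi
      refine ⟨1, fun t => ?_⟩
      have h := hasSum_single (f := fun k : ℤ => ((t - (k : ℝ) : ℝ) : ℂ) ^ 0 *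
        causalExpBSpline [0] (t - (k : ℝ))) ⌊t⌋ fun k hk => ?_
      · convert h using 1
        have : t - ⌊t⌋ ∈ Set.Ico (0 : ℝ) 1 := ⟨Int.fract_nonneg t, Int.fract_lt_one t⟩
        simp only [causalExpBSpline, expBSplineOne, Set.indicator_of_mem this]
        simp
      · have : t - (k : ℝ) ∉ Set.Ico (0 : ℝ) 1 := fun h =>
          hk (Int.floor_eq_iff.2 ⟨by linarith [h.1], by linarith [h.2]⟩).symm
        simp [causalExpBSpline, expBSplineOne, Set.indicator_of_notMem this]
    · have hG : ∀ l ∈ Finset.range (i + 1), ∃ c, HasPeriodization (fun t => ∫ s in (0 : ℝ)..1,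
          ((s : ℂ) ^ l * Complex.exp (b * s)) *
            (((t - s : ℝ) : ℂ) ^ (i - l) * causalExpBSpline r (t - s))) c := fun l hl => by
        by_cases hil : i - l < r.count 0
        · obtain ⟨c, hc⟩ := ih (i - l) hil
          exact ⟨_, hc.window_mul (integrable_pow_mul_causalExpBSpline r (i - l))
            (w := fun s : ℝ => (s : ℂ) ^ l * Complex.exp (b * s)) (by fun_prop)⟩
        · rw [List.count_cons] at hi
          have hb : b = 0 := by
            by_contra hb
            simp [hb] at hi
            omega
          subst hb
          simp only [beq_self_eq_true, if_true] at hi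
          have hl' := Finset.mem_range.1 hl
          obtain rfl : l = 0 := by omega
          refine ⟨∫ t : ℝ, (t : ℂ) ^ i * causalExpBSpline r t, ?_⟩
          simpa using hasPeriodization_window
            (integrable_pow_mul_causalExpBSpline r i)
      choose! c hc using hG
      refine ⟨∑ l ∈ Finset.range (i + 1), i.choose l * c l, ?_⟩
      convert HasPeriodization.sum (s := Finset.range (i + 1)) fun l hl =>
        (hc l hl).const_mul (i.choose l) using 2 with t
      rw [causalExpBSpline_cons b hr, ← intervalIntegral.integral_const_mul]
      simp only [← intervalIntegral.integral_const_mul]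
      rw [← intervalIntegral.integral_finsetSum]
      · refine intervalIntegral.integral_congr fun s _ => ?_
        rw [ofReal_pow_mul_eq_sum i t s]
        refine Finset.sum_congr rfl fun l _ => ?_
        ring
      · intro l _
        refine IntervalIntegrable.const_mul ?_ _
        exact ((integrable_pow_mul_causalExpBSpline r (i - l)).comp_sub_left
          t).intervalIntegrable.continuousOn_mul
          (by fun_prop : Continuous fun s : ℝ => (s : ℂ) ^ l * Complex.exp (b * s)).continuousOn

theorem integral_expBSplineOne_ne_zero {a : ℂ}
    (h : ∀ k : ℤ, a = 2 * Real.pi * Complex.I * k → a = 0) : ∫ t, expBSplineOne a t ≠ 0 := by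
  by_cases ha : a = 0
  · subst ha
    unfold expBSplineOne
    rw [integral_indicator measurableSet_Ico]
    simp
  · rw [integral_expBSplineOne a ha]
    refine div_ne_zero (fun he => ?_) (neg_ne_zero.2 ha)
    obtain ⟨k, hk⟩ := Complex.exp_eq_one_iff.1 (sub_eq_zero.1 he).symm
    exact ha (h k (by rw [hk]; ring))

theorem integral_causalExpBSpline_ne_zero {α : List ℂ} (hα : α ≠ [])
    (h : ∀ a ∈ α, ∀ k : ℤ, a = 2 * Real.pi * Complex.I * k → a = 0) :
    ∫ t, causalExpBSpline α t ≠ 0 := by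
  induction α with
  | nil => exact absurd rfl hα
  | cons a r ih =>
    have h1 := integral_expBSplineOne_ne_zero (h a (by simp))
    cases r with
    | nil => exact h1
    | cons b as =>
      simp only [causalExpBSpline]
      rw [integral_convolution (ContinuousLinearMap.mul ℂ ℂ) (integrable_expBSplineOne a)
        (integrable_causalExpBSpline (b :: as))]
      exact mul_ne_zero h1 (ih (by simp) fun c hc => h c (List.mem_cons_of_mem _ hc))

/-! ### Moments of generators -/

theorem HasPeriodization.tsum_half {f : ℝ → ℂ} {c : ℂ} (h : HasPeriodization f c) {w : ℤ → ℂ}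
    (hw : Summable fun n => ‖w n‖) :
    HasPeriodization (fun t => ∑' n : ℤ, w n * f (t - (n : ℝ) / 2)) ((∑' n, w n) * c) := by
  intro t
  set A : ℝ → ℝ := fun t => ∑' k : ℤ, ‖f (t - (k : ℝ))‖
  -- The periodization of `‖f‖` has period one, so half-integer shifts give only two values.
  have hA : ∀ n : ℤ, A (t - (n : ℝ) / 2) ≤ A t + A (t - 1 / 2) := fun n => by
    have hper : ∀ (s : ℝ) (p : ℤ), A (s - (p : ℝ)) = A s := fun s p => by
      have := (Equiv.addRight p).tsum_eq fun k : ℤ => ‖f (s - (k : ℝ))‖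
      simp only [A]
      rw [← this]
      refine tsum_congr fun k => ?_
      simp only [Equiv.coe_addRight, Int.cast_add]
      congr 2
      ring
    have hpos : ∀ s, 0 ≤ A s := fun s => tsum_nonneg fun k => norm_nonneg _
    rcases Int.even_or_odd' n with ⟨p, rfl | rfl⟩
    · have e : t - ((2 * p : ℤ) : ℝ) / 2 = t - (p : ℝ) := by
        push_cast
        ring
      rw [e, hper]
      linarith [hpos (t - 1 / 2)]
    · have e : t - ((2 * p + 1 : ℤ) : ℝ) / 2 = t - 1 / 2 - (p : ℝ) := by
        push_cast
        ring
      rw [e, hper]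
      linarith [hpos t]
  set F : ℤ × ℤ → ℂ := fun q => w q.1 * f (t - (q.1 : ℝ) / 2 - (q.2 : ℝ))
  have hF : Summable F := by
    refine Summable.of_norm ((summable_prod_of_nonneg fun q => norm_nonneg _).2 ⟨fun n => ?_, ?_⟩)
    · exact ((h (t - (n : ℝ) / 2)).mul_left (w n)).summable.norm
    · refine Summable.of_nonneg_of_le (fun n => tsum_nonneg fun k => norm_nonneg _) (fun n => ?_)
        (hw.mul_right (A t + A (t - 1 / 2)))
      simp only [F, norm_mul, tsum_mul_left]
      exact mul_le_mul_of_nonneg_left (hA n) (norm_nonneg _)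
  have h1 : HasSum (fun n => w n * c) (∑' q, F q) :=
    hF.hasSum.prod_fiberwise fun n => (h (t - (n : ℝ) / 2)).mul_left (w n)
  have h2 : HasSum (fun q : ℤ × ℤ => F q.swap) (∑' q, F q) :=
    (Equiv.prodComm ℤ ℤ).hasSum_iff.2 hF.hasSum
  have h3 := h2.prod_fiberwise fun k => (h2.summable.prod_factor k).hasSum
  rw [h1.unique (hw.of_norm.hasSum.mul_right c)] at h3
  refine h3.congr_fun fun k => tsum_congr fun n => ?_
  simp only [F, Prod.swap_prod_mk]
  rw [sub_right_comm]

theorem HasConstMoments.tsum_half {f : ℝ → ℂ} {N : ℕ} (h : HasConstMoments f N) {A B : ℝ}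
    (hf : ∀ t ∉ Set.Icc A B, f t = 0) {w : ℤ → ℂ}
    (hw : ∀ l < N, Summable fun n : ℤ => ‖w n‖ * |(n : ℝ)| ^ l) :
    HasConstMoments (fun t => ∑' n : ℤ, w n * f (t - (n : ℝ) / 2)) N := fun i hi => by
  choose! c hc using h
  have hs : ∀ (l : ℕ) (t : ℝ), Summable fun n : ℤ => w n * (((n : ℝ) / 2 : ℝ) : ℂ) ^ l *
      (((t - (n : ℝ) / 2 : ℝ) : ℂ) ^ (i - l) * f (t - (n : ℝ) / 2)) := fun l t =>
    summable_mul_comp_sub_half (f := fun t => (t : ℂ) ^ (i - l) * f t) (A := A) (B := B)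
      (fun t ht => by rw [hf t ht, mul_zero]) (fun n => w n * (((n : ℝ) / 2 : ℝ) : ℂ) ^ l) t
  have hG : ∀ l ∈ Finset.range (i + 1), HasPeriodization
      (fun t => ∑' n : ℤ, w n * (((n : ℝ) / 2 : ℝ) : ℂ) ^ l *
        (((t - (n : ℝ) / 2 : ℝ) : ℂ) ^ (i - l) * f (t - (n : ℝ) / 2)))
      ((∑' n : ℤ, w n * (((n : ℝ) / 2 : ℝ) : ℂ) ^ l) * c (i - l)) := fun l hl => by
    have hl' := Finset.mem_range.1 hl
    refine (hc (i - l) (by omega)).tsum_half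
      (w := fun n : ℤ => w n * (((n : ℝ) / 2 : ℝ) : ℂ) ^ l) ?_
    refine ((hw l (by omega)).mul_right ((2⁻¹ : ℝ) ^ l)).congr fun n => ?_
    rw [norm_mul, norm_pow, Complex.norm_real, Real.norm_eq_abs, abs_div, abs_two,
      div_eq_mul_inv, mul_pow, mul_assoc]
  refine ⟨∑ l ∈ Finset.range (i + 1),
    i.choose l * ((∑' n : ℤ, w n * (((n : ℝ) / 2 : ℝ) : ℂ) ^ l) * c (i - l)), ?_⟩
  convert HasPeriodization.sum (s := Finset.range (i + 1)) fun l hl =>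
    (hG l hl).const_mul (i.choose l) using 2 with t
  simp only [← tsum_mul_left]
  rw [← Summable.tsum_finsetSum fun l _ => (hs l t).mul_left _]
  refine tsum_congr fun n => ?_
  rw [mul_left_comm, ofReal_pow_mul_eq_sum i t ((n : ℝ) / 2), Finset.mul_sum]
  refine Finset.sum_congr rfl fun l _ => ?_
  ring

theorem cexp_mul_expBSpline (α : List ℂ) (a : ℂ) (t : ℝ) :
    Complex.exp (-a * t) * expBSpline α t = Complex.exp (a * (α.length / 2)) *
      causalExpBSpline (α.map (· - a)) (t + (α.length : ℝ) / 2) := by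
  rw [← causalExpBSpline_mul_exp, expBSpline, mul_left_comm, ← Complex.exp_add, mul_comm]
  congr 2
  push_cast
  ring

theorem hasConstMoments_cexp_mul_expBSpline (α : List ℂ) (a : ℂ) :
    HasConstMoments (fun t => Complex.exp (-a * t) * expBSpline α t) (α.count a) := by
  simp only [cexp_mul_expBSpline]
  have h := hasConstMoments_causalExpBSpline (α.map (· - a))
  have e : (α.map (· - a)).count 0 = α.count a := by
    rw [← List.count_map_of_injective α (· - a) sub_left_injective a, sub_self]
  rw [e] at h
  exact (h.comp_add _).const_mul _

/-- The zeroth moment is the integral of the B-spline, up to a nonzero factor; it does not vanish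
because no difference of roots is a nonzero multiple of `2πi`. -/
theorem exists_hasPeriodization_cexp_mul_expBSpline {α : List ℂ} {a : ℂ} (ha : a ∈ α)
    (hdist : ∀ b ∈ α, ∀ k : ℤ, b - a = 2 * Real.pi * Complex.I * k → b = a) :
    ∃ c ≠ 0, HasPeriodization (fun t => Complex.exp (-a * t) * expBSpline α t) c := by
  have h0 : 0 < (α.map (· - a)).count 0 :=
    List.count_pos_iff.2 (List.mem_map.2 ⟨a, ha, sub_self a⟩)
  obtain ⟨c, hc⟩ := hasConstMoments_causalExpBSpline (α.map (· - a)) 0 h0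
  simp only [pow_zero, one_mul] at hc
  refine ⟨_, mul_ne_zero (Complex.exp_ne_zero (a * (α.length / 2))) ?_,
    by simpa only [cexp_mul_expBSpline] using (hc.comp_add _).const_mul _⟩
  rw [hc.eq_integral (integrable_causalExpBSpline _)]
  refine integral_causalExpBSpline_ne_zero (List.ne_nil_of_mem (List.count_pos_iff.1 h0)) ?_
  intro x hx k hk
  obtain ⟨b, hb, rfl⟩ := List.mem_map.1 hx
  exact sub_eq_zero.2 (hdist b hb k hk)

theorem cexp_mul_generator (lam : ℤ → ℂ) (α : List ℂ) (a : ℂ) (t : ℝ) :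
    Complex.exp (-a * t) * generator lam α t = ∑' n : ℤ, lam n * Complex.exp (-a * n / 2) *
      (Complex.exp (-a * ((t - (n : ℝ) / 2 : ℝ) : ℂ)) * expBSpline α (t - (n : ℝ) / 2)) := by
  rw [generator, ← tsum_mul_left]
  refine tsum_congr fun n => ?_
  have : Complex.exp (-a * t) =
      Complex.exp (-a * n / 2) * Complex.exp (-a * ((t - (n : ℝ) / 2 : ℝ) : ℂ)) := by
    rw [← Complex.exp_add]
    congr 1
    push_cast
    ring
  rw [this]
  ring

theorem HasExpMoment.of_le {lam : ℤ → ℂ} {a : ℂ} {j l : ℕ} (h : HasExpMoment lam j a)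
    (h0 : Summable fun n : ℤ => ‖lam n‖ * ‖Complex.exp (-a * n / 2)‖) (hl : l ≤ j) :
    HasExpMoment lam l a := by
  refine Summable.of_nonneg_of_le (fun n => by positivity) (fun n => ?_) (h0.add h)
  have hp : |(n : ℝ)| ^ l ≤ 1 + |(n : ℝ)| ^ j := by
    rcases le_total |(n : ℝ)| 1 with h1 | h1
    · linarith [pow_le_one₀ (n := l) (abs_nonneg (n : ℝ)) h1, pow_nonneg (abs_nonneg (n : ℝ)) j]
    · linarith [pow_le_pow_right₀ h1 hl]
  calc ‖lam n‖ * |(n : ℝ)| ^ l * ‖Complex.exp (-a * n / 2)‖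
      ≤ ‖lam n‖ * (1 + |(n : ℝ)| ^ j) * ‖Complex.exp (-a * n / 2)‖ := by gcongr
    _ = _ := by ring

/-! ### Reproduction -/

/-- The space of functions reproduced by the integer translates of `g`. -/
def reproducedSpace (g : ℝ → ℂ) : Submodule ℂ (ℝ → ℂ) where
  carrier := {p | Reproduces g p}
  add_mem' := by
    rintro p q ⟨c, hc⟩ ⟨d, hd⟩
    exact ⟨c + d, fun t => by simpa only [Pi.add_apply, add_mul] using (hc t).add (hd t)⟩
  zero_mem' := ⟨0, fun t => by simp⟩
  smul_mem' := by
    rintro z p ⟨c, hc⟩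
    exact ⟨z • c, fun t => by
      simpa only [Pi.smul_apply, smul_eq_mul, mul_assoc] using (hc t).mul_left z⟩

/-- A Strang–Fix argument: writing `k = t - (t - k)`, the coefficients `k ^ j * exp (a k)` produce
`t ^ j * exp (a t)` times the zeroth moment plus a combination of monomials of lower degree. -/
theorem reproduces_expMonomial {g : ℝ → ℂ} {a : ℂ} {N : ℕ}
    (hg : HasConstMoments (fun t => Complex.exp (-a * t) * g t) N) {c₀ : ℂ} (hc₀ : c₀ ≠ 0)
    (h₀ : HasPeriodization (fun t => Complex.exp (-a * t) * g t) c₀) {j : ℕ} (hj : j < N) :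
    Reproduces g (expMonomial j a) := by
  induction j using Nat.strong_induction_on with
  | _ j ih =>
    choose! m hm using hg
    have hm0 : m 0 = c₀ := by
      have := hm 0 (by omega)
      simp only [pow_zero, one_mul] at this
      exact (this 0).unique (h₀ 0)
    set P : ℝ → ℂ := ∑ i ∈ Finset.range (j + 1),
      ((j.choose i : ℂ) * (-1) ^ i * m i) • expMonomial (j - i) a
    have hP : P ∈ reproducedSpace g := by
      refine ⟨fun k => (k : ℂ) ^ j * Complex.exp (a * k), fun t => ?_⟩
      have h := hasSum_sum (s := Finset.range (j + 1)) fun i hi =>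
        (hm i (by have := Finset.mem_range.1 hi; omega) t).mul_left
          ((j.choose i : ℂ) * (-1) ^ i * expMonomial (j - i) a t)
      have hPt : P t = ∑ i ∈ Finset.range (j + 1),
          (j.choose i : ℂ) * (-1) ^ i * expMonomial (j - i) a t * m i := by
        simp only [P, Finset.sum_apply, Pi.smul_apply, smul_eq_mul]
        refine Finset.sum_congr rfl fun i _ => ?_
        ring
      rw [hPt]
      refine h.congr_fun fun k => ?_
      have e1 : (k : ℂ) = -((t - (k : ℝ) : ℝ) : ℂ) + t := by
        push_cast
        ring
      have e2 : Complex.exp (a * k) =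
          Complex.exp (a * t) * Complex.exp (-a * ((t - (k : ℝ) : ℝ) : ℂ)) := by
        rw [← Complex.exp_add]
        congr 1
        push_cast
        ring
      beta_reduce
      rw [e2]
      conv_lhs => rw [e1, add_pow, Finset.sum_mul, Finset.sum_mul]
      refine Finset.sum_congr rfl fun i _ => ?_
      rw [neg_pow]
      simp only [expMonomial]
      ring
    have hlow : ∑ i ∈ Finset.range j, ((j.choose (i + 1) : ℂ) * (-1) ^ (i + 1) * m (i + 1)) •
        expMonomial (j - (i + 1)) a ∈ reproducedSpace g :=
      Submodule.sum_mem _ fun i hi => Submodule.smul_mem _ _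
        (ih (j - (i + 1)) (by have := Finset.mem_range.1 hi; omega) (by omega))
    have e : expMonomial j a = c₀⁻¹ • (P - ∑ i ∈ Finset.range j,
        ((j.choose (i + 1) : ℂ) * (-1) ^ (i + 1) * m (i + 1)) • expMonomial (j - (i + 1)) a) := by
      simp only [P]
      rw [Finset.sum_range_succ', add_sub_cancel_left, hm0]
      simp [smul_smul, hc₀]
    rw [e]
    exact Submodule.smul_mem (reproducedSpace g) _ (Submodule.sub_mem _ hP hlow)

theorem reproduces_generator_expMonomial {α : List ℂ} {a : ℂ} (ha : a ∈ α)
    (hdist : ∀ b ∈ α, ∀ k : ℤ, b - a = 2 * Real.pi * Complex.I * k → b = a) {lam : ℤ → ℂ}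
    (hsum : Summable fun n : ℤ => ‖lam n‖ * ‖Complex.exp (-a * n / 2)‖)
    (hne : ∑' n : ℤ, lam n * Complex.exp (-a * n / 2) ≠ 0) {j : ℕ} (hj : j < α.count a)
    (hmom : HasExpMoment lam j a) : Reproduces (generator lam α) (expMonomial j a) := by
  obtain ⟨c, hc, hper⟩ := exists_hasPeriodization_cexp_mul_expBSpline ha hdist
  have hcm : HasConstMoments (fun t => Complex.exp (-a * t) * expBSpline α t) (j + 1) :=
    fun i hi => hasConstMoments_cexp_mul_expBSpline α a i (by omega)
  refine reproduces_expMonomial (N := j + 1) (c₀ := (∑' n : ℤ, lam n * Complex.exp (-a * n / 2)) * c)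
    ?_ (mul_ne_zero hne hc) ?_ (Nat.lt_succ_self j)
  · simp only [cexp_mul_generator]
    refine hcm.tsum_half (w := fun n : ℤ => lam n * Complex.exp (-a * n / 2))
      (fun t ht => by rw [expBSpline_eq_zero α ht, mul_zero]) fun l hl => ?_
    refine Summable.congr (hmom.of_le hsum (Nat.lt_succ_iff.1 hl)) fun n => ?_
    rw [norm_mul]
    ring
  · simp only [cexp_mul_generator]
    exact hper.tsum_half (w := fun n : ℤ => lam n * Complex.exp (-a * n / 2))
      (by simpa only [norm_mul] using hsum)

theorem generator_single (α : List ℂ) : generator (Pi.single 0 1) α = expBSpline α := by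
  ext t
  rw [generator, tsum_eq_single 0 fun n hn => by simp [hn]]
  simp

/-- The conditions on the weights are met by the unit mass at `0`, whose generator is the B-spline
itself. -/
theorem reproduces_expBSpline_expMonomial {α : List ℂ} {a : ℂ} (ha : a ∈ α)
    (hdist : ∀ b ∈ α, ∀ k : ℤ, b - a = 2 * Real.pi * Complex.I * k → b = a) {j : ℕ}
    (hj : j < α.count a) : Reproduces (expBSpline α) (expMonomial j a) := by
  rw [← generator_single]
  refine reproduces_generator_expMonomial ha hdist ?_ ?_ hj ?_
  · exact summable_of_ne_finset_zero (s := {0}) fun n hn => by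
      simp [Finset.mem_singleton.not.1 hn]
  · rw [tsum_eq_single 0 fun n hn => by simp [hn]]
    simp
  · exact summable_of_ne_finset_zero (s := {0}) fun n hn => by
      simp [Finset.mem_singleton.not.1 hn]

theorem expSpace_le_reproducedSpace {α : List ℂ} {g : ℝ → ℂ}
    (h : ∀ a ∈ α, ∀ j < α.count a, Reproduces g (expMonomial j a)) :
    expSpace α ≤ reproducedSpace g := by
  refine Submodule.span_le.2 ?_
  rintro _ ⟨j, a, hj, rfl⟩
  exact h a (List.count_pos_iff.1 (by omega)) j hj

theorem proposition2 (α : List ℂ) (hα : α ≠ [])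
    (hdist : ∀ a ∈ α, ∀ b ∈ α, ∀ k : ℤ, a - b = 2 * Real.pi * Complex.I * k → a = b)
    (lam : ℤ → ℂ) (hlam : Summable fun n : ℤ => ‖lam n‖)
    (hsum : ∀ a ∈ α, Summable fun n : ℤ => ‖lam n‖ * ‖Complex.exp (-a * n / 2)‖)
    (hne : ∀ a ∈ α, ∑' n : ℤ, lam n * Complex.exp (-a * n / 2) ≠ 0) :
    (∀ a ∈ α, ∀ n : ℕ, 1 ≤ n → n ≤ α.count a → HasExpMoment lam (n - 1) a →
      Reproduces (generator lam α) (expMonomial (n - 1) a)) ∧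
    ((∀ a ∈ α, HasExpMoment lam (α.count a - 1) a) →
      (∀ p : ℝ → ℂ, ContDiff ℝ α.length p → (∀ t, expDiffOp α p t = 0) →
        Reproduces (generator lam α) p) ∧
      (∀ p : ℝ → ℂ, IsExpPolynomial p →
        (Reproduces (expBSpline α) p ↔ Reproduces (generator lam α) p))) := by
  have hd : ∀ a ∈ α, ∀ b ∈ α, ∀ k : ℤ, b - a = 2 * Real.pi * Complex.I * k → b = a :=
    fun a ha b hb => hdist b hb a ha
  refine ⟨fun a ha n h1 hn hmom => reproduces_generator_expMonomial ha (hd a ha) (hsum a ha)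
    (hne a ha) (by omega) hmom, fun hmom => ?_⟩
  have hgen : expSpace α ≤ reproducedSpace (generator lam α) :=
    expSpace_le_reproducedSpace fun a ha j hj =>
      reproduces_generator_expMonomial ha (hd a ha) (hsum a ha) (hne a ha) hj
        ((hmom a ha).of_le (hsum a ha) (by omega))
  have hspl : expSpace α ≤ reproducedSpace (expBSpline α) :=
    expSpace_le_reproducedSpace fun a ha j hj => reproduces_expBSpline_expMonomial ha (hd a ha) hj
  refine ⟨fun p hp h => hgen (mem_expSpace_of_expDiffOp_eq_zero α hp h),
    fun p hp => ⟨fun h => hgen ?_, fun h => hspl ?_⟩⟩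
  · rw [← generator_single] at h
    exact mem_expSpace_of_reproduces (isPiecewiseExp_generator _ α) hp h
  · exact mem_expSpace_of_reproduces (isPiecewiseExp_generator lam α) hp h

end
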